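/- Let $p$ be a prime and let $s,m,n$ be integers with $s\ge 1$, $m\ge 1$ and $n\ge 2m$. Write $\mathbb Z_{p^s}=\mathbb Z/p^s\mathbb Z$. A finite family of $k$ vectors of $\mathbb Z_{p^s}^n$ is called unimodular if the $k\times n$ matrix with these rows has a right inverse. The dimension of a submodule $V\subseteq\mathbb Z_{p^s}^n$ is the largest number of vectors in a unimodular family contained in $V$, and a $k$-subspace is a submodule having a unimodular basis of $k$ vectors (the $0$-subspace is $\{0\}$). The Grassmann graph $G_{p^s}(n,m)$ is the simple graph whose vertices are the $m$-subspaces of $\mathbb Z_{p^s}^n$, two distinct vertices being adjacent if their intersection has dimension $m-1$. A maximum clique is a clique of largest cardinality, and the clique number $\omega$ is that cardinality. A star is the set of all $m$-subspaces containing a fixed $(m-1)$-subspace, and a top is the set of all $m$-subspaces contained in a fixed $(m+1)$-subspace. Let $\pi$ be reduction modulo $p$, which maps an $m$-subspace of $\mathbb Z_{p^s}^n$ with basis $\alpha_1,\dots,\alpha_m$ to the $m$-subspace of $\mathbb Z_p^n$ with basis $\alpha_1 \bmod p,\dots,\alpha_m \bmod p$. Finally let ${a \brack b}_q=\prod_{i=1}^{b}\frac{q^{a+1-i}-1}{q^{i}-1}$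 be the Gaussian binomial coefficient. Then: (i) $\displaystyle \omega\bigl(G_{p^s}(n,m)\bigr)=p^{(s-1)(n-m)}{n-m+1\brack 1}_p$. (ii) For every maximum clique $\mathcal M$ of $G_{p^s}(n,m)$, the set $\pi(\mathcal M)=\{\pi(X):X\in\mathcal M\}$ is a star in $G_p(n,m)$ if $n>2m$, and is a star or a top in $G_p(n,m)$ if $n=2m$. -/

import Mathlib

namespace Grassmann

/-- A `k × n` matrix over `R`, seen as the family of its `k` rows (vectors of `Rⁿ`), is unimodular
if it has a right inverse. -/
def IsUnimodular {R : Type*} [CommRing R] {k n : ℕ} (A : Matrix (Fin k) (Fin n) R) : Prop :=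
  ∃ B : Matrix (Fin n) (Fin k) R, A * B = 1

/-- The rows of a unimodular matrix are linearly independent. -/
theorem IsUnimodular.linearIndependent {R : Type*} [CommRing R] {k n : ℕ}
    {A : Matrix (Fin k) (Fin n) R} (hA : IsUnimodular A) : LinearIndependent R A.row := by
  obtain ⟨B, hB⟩ := hA
  rw [← Matrix.vecMul_injective_iff]
  intro x y hxy
  have h := congrArg (fun v => Matrix.vecMul v B) hxy
  simpa [Matrix.vecMul_vecMul, hB] using h

/-- The dimension of a linear subset (submodule) `V` of `Rⁿ`: the largest number of vectors in a
unimodular family of vectors of `V`. -/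
noncomputable def dim {R : Type*} [CommRing R] {n : ℕ} (V : Submodule R (Fin n → R)) : ℕ :=
  sSup {k : ℕ | ∃ A : Matrix (Fin k) (Fin n) R, IsUnimodular A ∧ ∀ i, A.row i ∈ V}

/-- The set whose supremum defines `dim` is bounded (and it contains `0`), so that `dim` is a
maximum. -/
theorem bddAbove_dim {R : Type*} [CommRing R] [Nontrivial R] {n : ℕ}
    (V : Submodule R (Fin n → R)) :
    BddAbove {k : ℕ | ∃ A : Matrix (Fin k) (Fin n) R, IsUnimodular A ∧ ∀ i, A.row i ∈ V} := by
  refine ⟨n, ?_⟩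
  rintro k ⟨A, hA, -⟩
  simpa using hA.linearIndependent.fintype_card_le_finrank

/-- `X` is a `k`-subspace of `Rⁿ`: it has a basis `α₁, …, αₖ` that is unimodular (linear
independence is automatic by `IsUnimodular.linearIndependent`). For `k = 0` this is `X = {0}`. -/
def IsSubspace {R : Type*} [CommRing R] {n : ℕ} (k : ℕ) (X : Submodule R (Fin n → R)) : Prop :=
  ∃ A : Matrix (Fin k) (Fin n) R, IsUnimodular A ∧ Submodule.span R (Set.range A.row) = X

/-- The set of all `m`-subspaces of `Rⁿ`. -/
def Vertex (R : Type*) [CommRing R] (n m : ℕ) : Type _ :=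
  {X : Submodule R (Fin n → R) // IsSubspace m X}

instance {R : Type*} [CommRing R] [Finite R] (n m : ℕ) : Finite (Vertex R n m) :=
  inferInstanceAs (Finite {X : Submodule R (Fin n → R) // IsSubspace m X})

/-- The Grassmann graph: the vertices are the `m`-subspaces of `Rⁿ`, and two (distinct) vertices
are adjacent if their intersection is a linear subset of dimension `m - 1`. -/
def graph (R : Type*) [CommRing R] (n m : ℕ) : SimpleGraph (Vertex R n m) where
  Adj A B := A ≠ B ∧ dim (A.1 ⊓ B.1) + 1 = m
  symm := ⟨fun A B h => ⟨h.1.symm, by rw [inf_comm]; exact h.2⟩⟩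
  loopless := ⟨fun _ h => h.1 rfl⟩

/-- A star: the set of all `m`-subspaces containing some fixed `(m-1)`-subspace `P`. -/
def IsStar {R : Type*} [CommRing R] {n m : ℕ} (C : Set (Vertex R n m)) : Prop :=
  ∃ (k : ℕ) (P : Submodule R (Fin n → R)),
    k + 1 = m ∧ IsSubspace k P ∧ C = {X : Vertex R n m | P ≤ X.1}

/-- A top: the set of all `m`-subspaces contained in some fixed `(m+1)`-subspace `Q`. -/
def IsTop {R : Type*} [CommRing R] {n m : ℕ} (C : Set (Vertex R n m)) : Prop :=
  ∃ Q : Submodule R (Fin n → R), IsSubspace (m + 1) Q ∧ C = {X : Vertex R n m | X.1 ≤ Q}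

/-- The submodule of `Sⁿ` spanned by the coordinatewise images, under a ring homomorphism
`f : R → S`, of the vectors of `X`. -/
def baseChange {R S : Type*} [CommRing R] [CommRing S] (f : R →+* S) {n : ℕ}
    (X : Submodule R (Fin n → R)) : Submodule S (Fin n → S) :=
  Submodule.span S ((fun v : Fin n → R => f ∘ v) '' (X : Set (Fin n → R)))

/-- If `A` is a matrix representation of `X`, then the entrywise image `f(A)` is a matrix
representation of `baseChange f X`. -/
theorem baseChange_span {R S : Type*} [CommRing R] [CommRing S] (f : R →+* S) {k n : ℕ}
    (A : Matrix (Fin k) (Fin n) R) :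
    baseChange f (Submodule.span R (Set.range A.row)) =
      Submodule.span S (Set.range (A.map f).row) := by
  apply le_antisymm
  · refine Submodule.span_le.2 ?_
    rintro _ ⟨v, hv, rfl⟩
    induction hv using Submodule.span_induction with
    | mem x hx =>
      obtain ⟨i, rfl⟩ := hx
      exact Submodule.subset_span ⟨i, rfl⟩
    | zero =>
      have h : (f ∘ (0 : Fin n → R)) = 0 := by ext; simp
      simp only [h]
      exact Submodule.zero_mem _
    | add x y _ _ hx hy =>
      have h : (f ∘ (x + y)) = f ∘ x + f ∘ y := by ext; simp
      simp only [h]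
      exact Submodule.add_mem _ hx hy
    | smul a x _ hx =>
      have h : (f ∘ (a • x)) = f a • (f ∘ x) := by ext; simp
      simp only [h]
      exact Submodule.smul_mem _ _ hx
  · refine Submodule.span_mono ?_
    rintro _ ⟨i, rfl⟩
    exact ⟨A.row i, Submodule.subset_span ⟨i, rfl⟩, rfl⟩

theorem IsSubspace.baseChange {R S : Type*} [CommRing R] [CommRing S] (f : R →+* S) {k n : ℕ}
    {X : Submodule R (Fin n → R)} (hX : IsSubspace k X) :
    IsSubspace k (Grassmann.baseChange f X) := by
  obtain ⟨A, ⟨B, hB⟩, rfl⟩ := hX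
  refine ⟨A.map f, ⟨B.map f, ?_⟩, (baseChange_span f A).symm⟩
  rw [← Matrix.map_mul, hB, Matrix.map_one f (map_zero f) (map_one f)]

/-- Reduction modulo `p` of the `m`-subspaces of `(ℤ/pˢ)ⁿ`: a subspace with matrix representation
`A` is sent to the subspace of `(ℤ/p)ⁿ` with matrix representation `A mod p`. -/
def reduction (p s n m : ℕ) (hs : s ≠ 0) (X : Vertex (ZMod (p ^ s)) n m) : Vertex (ZMod p) n m :=
  ⟨baseChange (ZMod.castHom (dvd_pow_self p hs) (ZMod p)) X.1, X.2.baseChange _⟩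

/-- The Gaussian binomial coefficient `[n choose m]_q = ∏_{i=1}^m (q^(n+1-i) - 1) / (q^i - 1)`,
for `q ≥ 2`, as a rational number. -/
def gaussBinom (q n m : ℕ) : ℚ :=
  ∏ i ∈ Finset.Icc 1 m, ((q : ℚ) ^ (n + 1 - i) - 1) / ((q : ℚ) ^ i - 1)

end Grassmann

/-! Reduction modulo `p` sends a clique to a clique, so a clique has at most (largest fibre) times
(clique number over `ZMod p`) elements. Over the field, pairwise adjacent spaces share a hyperplane
or lie in a common `(m+1)`-space (`exists_forall_le_or_exists_forall_ge`). Counting gives at most `1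
+ p + ⋯ + p^(n-m)` of them, with equality only for a full star, or a full top when `n = 2m`. Fibres
are bounded one power of `p` at a time (`card_le_of_baseChange_eq`). Subspaces with the same image
one level down have normalized bases that differ by a top power of `p` times a matrix over `ZMod p`,
whose rows lie in a fixed space of dimension `n - m`. Adjacency forces these differences to have
rank one. A linear map to the field with `p^(n-m)` elements that vanishes on no nonzero rank-one
matrix is then injective on the clique part of the fibre. A star attains the product
(`exists_isClique_le_card`). A maximum clique therefore has an image of extremal size, hence a star
or a top. -/

namespace Grassmann

open Matrix

/-! ### Unimodular families and subspaces over a commutative ring -/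

section General

variable {R S : Type*} [CommRing R] [CommRing S] {k m n : ℕ}

theorem mem_span_row_iff (A : Matrix (Fin m) (Fin n) R) (v : Fin n → R) :
    v ∈ Submodule.span R (Set.range A.row) ↔ ∃ c, c ᵥ* A = v := by
  rw [← range_vecMulLinear]; rfl

theorem forall_row_mem_span_iff (M : Matrix (Fin k) (Fin n) R) (A : Matrix (Fin m) (Fin n) R) :
    (∀ i, M.row i ∈ Submodule.span R (Set.range A.row)) ↔
      ∃ C : Matrix (Fin k) (Fin m) R, M = C * A := by
  simp only [mem_span_row_iff]
  constructor
  · intro h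
    choose C hC using h
    refine ⟨Matrix.of C, ?_⟩
    ext i j
    exact (congrFun (hC i) j).symm
  · rintro ⟨C, rfl⟩ i
    exact ⟨C.row i, rfl⟩

theorem span_row_mul_le (C : Matrix (Fin k) (Fin m) R) (A : Matrix (Fin m) (Fin n) R) :
    Submodule.span R (Set.range (C * A).row) ≤ Submodule.span R (Set.range A.row) := by
  rw [Submodule.span_le]
  rintro _ ⟨i, rfl⟩
  exact (forall_row_mem_span_iff (C * A) A).2 ⟨C, rfl⟩ i

theorem span_row_mul_of_isUnit {C : Matrix (Fin m) (Fin m) R} (hC : IsUnit C)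
    (A : Matrix (Fin m) (Fin n) R) :
    Submodule.span R (Set.range (C * A).row) = Submodule.span R (Set.range A.row) := by
  refine (span_row_mul_le C A).antisymm ?_
  obtain ⟨u, rfl⟩ := hC
  have h := span_row_mul_le (↑u⁻¹ : Matrix (Fin m) (Fin m) R) (u.1 * A)
  rwa [← Matrix.mul_assoc, Units.inv_mul, Matrix.one_mul] at h

theorem IsUnimodular.of_mul {C : Matrix (Fin k) (Fin m) R} {A : Matrix (Fin m) (Fin n) R}
    (h : IsUnimodular (C * A)) : IsUnimodular C := by
  obtain ⟨B, hB⟩ := h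
  exact ⟨A * B, by rw [← Matrix.mul_assoc, hB]⟩

theorem IsUnimodular.map {A : Matrix (Fin k) (Fin n) R} (hA : IsUnimodular A) (f : R →+* S) :
    IsUnimodular (A.map f) := by
  obtain ⟨B, hB⟩ := hA
  exact ⟨B.map f, by rw [← Matrix.map_mul, hB, Matrix.map_one f (map_zero f) (map_one f)]⟩

/-- A unimodular family of `m` vectors in an `m`-subspace spans it. -/
theorem IsSubspace.span_eq {X : Submodule R (Fin n → R)} (hX : IsSubspace m X)
    {A : Matrix (Fin m) (Fin n) R} (hA : IsUnimodular A) (h : ∀ i, A.row i ∈ X) :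
    Submodule.span R (Set.range A.row) = X := by
  obtain ⟨A', -, rfl⟩ := hX
  obtain ⟨C, rfl⟩ := (forall_row_mem_span_iff A A').1 h
  obtain ⟨D, hD⟩ := hA.of_mul
  exact span_row_mul_of_isUnit (.of_mul_eq_one _ hD) A'

theorem IsSubspace.le_of_unimodular [Nontrivial R] {X : Submodule R (Fin n → R)}
    (hX : IsSubspace m X) {A : Matrix (Fin k) (Fin n) R} (hA : IsUnimodular A)
    (h : ∀ i, A.row i ∈ X) : k ≤ m := by
  obtain ⟨A', -, rfl⟩ := hX
  obtain ⟨C, rfl⟩ := (forall_row_mem_span_iff A A').1 h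
  simpa using hA.of_mul.linearIndependent.fintype_card_le_finrank

/-- The intersection of `X` and `Y` contains a unimodular family of `k` vectors. -/
def Close (k : ℕ) (X Y : Submodule R (Fin n → R)) : Prop :=
  ∃ U : Matrix (Fin k) (Fin n) R, IsUnimodular U ∧ ∀ i, U.row i ∈ X ⊓ Y

theorem le_dim_of_unimodular [Nontrivial R] {V : Submodule R (Fin n → R)}
    {A : Matrix (Fin k) (Fin n) R} (hA : IsUnimodular A) (h : ∀ i, A.row i ∈ V) : k ≤ dim V :=
  le_csSup (bddAbove_dim V) ⟨A, hA, h⟩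

theorem exists_unimodular_dim [Nontrivial R] (V : Submodule R (Fin n → R)) :
    ∃ A : Matrix (Fin (dim V)) (Fin n) R, IsUnimodular A ∧ ∀ i, A.row i ∈ V :=
  Nat.sSup_mem (s := {k : ℕ | ∃ A : Matrix (Fin k) (Fin n) R, IsUnimodular A ∧ ∀ i, A.row i ∈ V})
    ⟨0, Matrix.of Fin.elim0, ⟨Matrix.of fun _ => Fin.elim0, Subsingleton.elim _ _⟩,
      fun i => i.elim0⟩ (bddAbove_dim V)

/-- Dimension at least `k` already suffices: `k + 1` unimodular vectors in the intersection would
span both vertices and make them equal. Unlike an exact dimension, `Close` visibly passes through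
ring homomorphisms. -/
theorem graph_adj_iff [Nontrivial R] (X Y : Vertex R n (k + 1)) :
    (graph R n (k + 1)).Adj X Y ↔ X ≠ Y ∧ Close k X.1 Y.1 := by
  refine and_congr_right fun hne => ⟨fun h => ?_, ?_⟩
  · obtain ⟨A, hA⟩ := exists_unimodular_dim (X.1 ⊓ Y.1)
    have h := Nat.succ_injective h
    generalize dim (X.1 ⊓ Y.1) = d at *
    subst h
    exact ⟨A, hA⟩
  · rintro ⟨U, hU, hmem⟩
    have h1 := le_dim_of_unimodular hU hmem
    obtain ⟨A, hA, hAmem⟩ := exists_unimodular_dim (X.1 ⊓ Y.1)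
    have h2 := X.2.le_of_unimodular hA fun i => (hAmem i).1
    rcases h2.eq_or_lt with h | h
    · exfalso
      generalize dim (X.1 ⊓ Y.1) = d at *
      subst h
      exact hne (Subtype.ext ((X.2.span_eq hA fun i => (hAmem i).1).symm.trans
        (Y.2.span_eq hA fun i => (hAmem i).2)))
    · omega

theorem comp_mem_baseChange (f : R →+* S) {X : Submodule R (Fin n → R)} {v : Fin n → R}
    (hv : v ∈ X) : f ∘ v ∈ baseChange f X :=
  Submodule.subset_span ⟨v, hv, rfl⟩

theorem Close.baseChange (f : R →+* S) {X Y : Submodule R (Fin n → R)} (h : Close k X Y) :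
    Close k (Grassmann.baseChange f X) (Grassmann.baseChange f Y) := by
  obtain ⟨U, hU, hmem⟩ := h
  exact ⟨U.map f, hU.map f, fun i =>
    ⟨comp_mem_baseChange f (hmem i).1, comp_mem_baseChange f (hmem i).2⟩⟩

theorem IsSubspace.baseChange_baseChange {T : Type*} [CommRing T] (f : R →+* S) (g : S →+* T)
    {X : Submodule R (Fin n → R)} (hX : IsSubspace m X) :
    Grassmann.baseChange g (Grassmann.baseChange f X) = Grassmann.baseChange (g.comp f) X := by
  obtain ⟨A, -, rfl⟩ := hX
  simp only [baseChange_span, Matrix.map_map]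
  rfl

/-- Subspaces with the same image under a local homomorphism `f` as the row space of `A₀` have a
basis that agrees with `A₀` under `f` and has the same right inverse. -/
theorem IsSubspace.exists_normalized_basis (f : R →+* S) [IsLocalHom f]
    {A₀ : Matrix (Fin m) (Fin n) R} {B : Matrix (Fin n) (Fin m) R} (hB : A₀ * B = 1)
    {X : Submodule R (Fin n → R)} (hX : IsSubspace m X)
    (h : Grassmann.baseChange f X =
      Grassmann.baseChange f (Submodule.span R (Set.range A₀.row))) :
    ∃ A : Matrix (Fin m) (Fin n) R, A * B = 1 ∧ Submodule.span R (Set.range A.row) = X ∧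
      A.map f = A₀.map f := by
  obtain ⟨A, ⟨B', hB'⟩, rfl⟩ := hX
  rw [baseChange_span, baseChange_span] at h
  obtain ⟨C, hC⟩ := (forall_row_mem_span_iff (A.map f) (A₀.map f)).1 fun i =>
    h ▸ Submodule.subset_span ⟨i, rfl⟩
  obtain ⟨C', hC'⟩ := (forall_row_mem_span_iff (A₀.map f) (A.map f)).1 fun i =>
    h ▸ Submodule.subset_span ⟨i, rfl⟩
  have e1 : (A * B).map f = C := by
    rw [Matrix.map_mul, hC, Matrix.mul_assoc, ← Matrix.map_mul, hB,
      Matrix.map_one f (map_zero f) (map_one f), Matrix.mul_one]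
  have e2 : C * C' = 1 := by
    have e3 : A.map f = C * C' * A.map f := by
      rw [Matrix.mul_assoc, ← hC', ← hC]
    have e4 := congrArg (· * B'.map f) e3
    simp only [Matrix.mul_assoc, ← Matrix.map_mul, hB',
      Matrix.map_one f (map_zero f) (map_one f), Matrix.mul_one] at e4
    exact e4.symm
  -- `A * B` reduces to the invertible matrix `C`, so locality of `f` makes it invertible; the
  -- normalized basis is `(A * B)⁻¹ * A`.
  have hu : IsUnit (A * B) := by
    rw [Matrix.isUnit_iff_isUnit_det]
    apply isUnit_of_map_unit f
    rw [RingHom.map_det, RingHom.mapMatrix_apply, e1, ← Matrix.isUnit_iff_isUnit_det]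
    exact IsUnit.of_mul_eq_one _ e2
  obtain ⟨u, hu⟩ := hu
  refine ⟨(↑u⁻¹ : Matrix (Fin m) (Fin m) R) * A, ?_, span_row_mul_of_isUnit u⁻¹.isUnit A, ?_⟩
  · rw [Matrix.mul_assoc, ← hu, Units.inv_mul]
  · have e5 : ((↑u⁻¹ : Matrix (Fin m) (Fin m) R)).map f * C = 1 := by
      rw [← e1, ← hu, ← Matrix.map_mul, Units.inv_mul, Matrix.map_one f (map_zero f) (map_one f)]
    rw [Matrix.map_mul, hC, ← Matrix.mul_assoc, e5, Matrix.one_mul]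

end General

/-! ### Matrices of rank one over a field -/

section RankOne

variable {F L : Type*} [Field F] [Field L] [Algebra F L] {k n : ℕ}

/-- A matrix over a field killed on the left by a unimodular `k × (k + 1)` matrix has rank at most
one. -/
theorem exists_eq_vecMulVec_of_mul_eq_zero {C : Matrix (Fin k) (Fin (k + 1)) F}
    (hC : IsUnimodular C) {E : Matrix (Fin (k + 1)) (Fin n) F} (hE : C * E = 0) :
    ∃ u : Fin (k + 1) → F, u ≠ 0 ∧ ∃ w : Fin n → F, E = vecMulVec u w := by
  obtain ⟨W, hW⟩ := hC
  have hsurj : Function.Surjective C.mulVecLin := fun x =>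
    ⟨W *ᵥ x, by simp [Matrix.mulVec_mulVec, hW]⟩
  have hrank := LinearMap.finrank_range_add_finrank_ker C.mulVecLin
  rw [LinearMap.range_eq_top.2 hsurj, finrank_top] at hrank
  simp only [Module.finrank_fintype_fun_eq_card, Fintype.card_fin] at hrank
  -- `C` is onto, so its kernel is a line; every column of `E` lies on it.
  obtain ⟨⟨u, hu⟩, hu0, hspan⟩ := finrank_eq_one_iff'.1
    (show Module.finrank F (LinearMap.ker C.mulVecLin) = 1 by omega)
  have hcol : ∀ j, ∃ c : F, c • u = E.col j := by
    intro j
    have hj : E.col j ∈ LinearMap.ker C.mulVecLin := by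
      rw [LinearMap.mem_ker]
      ext i
      exact congrFun (congrFun hE i) j
    obtain ⟨c, hc⟩ := hspan ⟨_, hj⟩
    exact ⟨c, congrArg Subtype.val hc⟩
  choose w hw using hcol
  refine ⟨u, fun h => hu0 (Subtype.ext h), w, ?_⟩
  ext i j
  rw [vecMulVec_apply, mul_comm]
  exact (congrFun (hw j) i).symm

/-- A functional on matrices that does not vanish on nonzero matrices of rank one. -/
theorem eq_zero_of_sum_mul_eq_zero {θ : Fin (k + 1) → L} (hθ : LinearIndependent F θ)
    {φ : (Fin n → F) →ₗ[F] L} {K : Submodule F (Fin n → F)} (hφ : ∀ w ∈ K, φ w = 0 → w = 0)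
    {C : Matrix (Fin k) (Fin (k + 1)) F} (hC : IsUnimodular C)
    {E : Matrix (Fin (k + 1)) (Fin n) F} (hE : C * E = 0) (hK : ∀ i, E i ∈ K)
    (h : ∑ i, θ i * φ (E i) = 0) : E = 0 := by
  obtain ⟨u, hu, w, rfl⟩ := exists_eq_vecMulVec_of_mul_eq_zero hC hE
  have hrow : ∀ i, vecMulVec u w i = u i • w := fun i => by
    ext j; simp [vecMulVec_apply]
  obtain ⟨i, hi⟩ := Function.ne_iff.1 hu
  have hw : w ∈ K := by
    have := K.smul_mem (u i)⁻¹ (hK i)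
    rwa [hrow, smul_smul, inv_mul_cancel₀ hi, one_smul] at this
  -- For rank one the sum factors as `(∑ u i • θ i) * φ w`, a product in a field.
  simp only [hrow, map_smul, mul_smul_comm, ← smul_mul_assoc, ← Finset.sum_mul] at h
  rcases mul_eq_zero.1 h with h | h
  · exact absurd (Fintype.linearIndependent_iff.1 hθ u h i) hi
  · rw [hφ w hw h]
    ext i j
    simp [vecMulVec_apply]

end RankOne

/-! ### Cliques inside a fibre of reduction -/

section Fibre

variable {p : ℕ} [hp : Fact p.Prime]

instance (s : ℕ) : Nontrivial (ZMod (p ^ (s + 1))) :=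
  ZMod.nontrivial_iff.2 (Nat.one_lt_pow s.succ_ne_zero hp.out.one_lt).ne'

instance (s : ℕ) : IsLocalRing (ZMod (p ^ (s + 1))) :=
  IsLocalRing.of_surjective' (PadicInt.toZModPow (p := p) (s + 1)) (ZMod.ringHom_surjective _)

/-- The embedding of `ℤ/p` into `ℤ/pˢ⁺²` given by multiplication by `pˢ⁺¹`. -/
def mulPow (p s : ℕ) [Fact p.Prime] (x : ZMod p) : ZMod (p ^ (s + 2)) :=
  (p : ZMod (p ^ (s + 2))) ^ (s + 1) * (x.val : ZMod (p ^ (s + 2)))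

/-- Any representative may replace `val`, since `p^(s+1) * p = 0` in the target. -/
theorem mulPow_natCast (s a : ℕ) :
    mulPow p s (a : ZMod p) = ((p ^ (s + 1) * a : ℕ) : ZMod (p ^ (s + 2))) := by
  rw [mulPow, ZMod.val_natCast]
  norm_cast
  rw [ZMod.natCast_eq_natCast_iff, pow_succ p (s + 1)]
  exact (Nat.mod_modEq a p).mul_left' _

theorem mulPow_add (s : ℕ) (x y : ZMod p) : mulPow p s (x + y) = mulPow p s x + mulPow p s y := by
  obtain ⟨a, rfl⟩ := ZMod.natCast_zmod_surjective x
  obtain ⟨b, rfl⟩ := ZMod.natCast_zmod_surjective y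
  rw [← Nat.cast_add, mulPow_natCast, mulPow_natCast, mulPow_natCast]
  push_cast
  ring

/-- Scalars act on multiples of `p^(s+1)` through their residues mod `p`, so matrix equations
between such multiples descend to `ZMod p`. -/
theorem mulPow_mul (s : ℕ) (g : ZMod (p ^ (s + 2)) →+* ZMod p) (a : ZMod (p ^ (s + 2)))
    (x : ZMod p) : mulPow p s (g a * x) = a * mulPow p s x := by
  obtain ⟨a, rfl⟩ := ZMod.natCast_zmod_surjective a
  obtain ⟨x, rfl⟩ := ZMod.natCast_zmod_surjective x
  rw [map_natCast, ← Nat.cast_mul, mulPow_natCast, mulPow_natCast]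
  push_cast
  ring

theorem mulPow_eq_zero (s : ℕ) {x : ZMod p} (h : mulPow p s x = 0) : x = 0 := by
  obtain ⟨a, rfl⟩ := ZMod.natCast_zmod_surjective x
  rw [mulPow_natCast, ZMod.natCast_eq_zero_iff, pow_succ p (s + 1)] at h
  rw [ZMod.natCast_eq_zero_iff]
  exact Nat.dvd_of_mul_dvd_mul_left (pow_pos hp.out.pos _) h

theorem exists_mulPow_eq (s : ℕ) (f : ZMod (p ^ (s + 2)) →+* ZMod (p ^ (s + 1)))
    {a : ZMod (p ^ (s + 2))} (ha : f a = 0) : ∃ x, mulPow p s x = a := by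
  obtain ⟨a, rfl⟩ := ZMod.natCast_zmod_surjective a
  rw [map_natCast, ZMod.natCast_eq_zero_iff] at ha
  obtain ⟨b, rfl⟩ := ha
  exact ⟨b, mulPow_natCast s b⟩

/-- `mulPow` as an additive homomorphism. -/
def mulPowHom (p s : ℕ) [Fact p.Prime] : ZMod p →+ ZMod (p ^ (s + 2)) :=
  AddMonoidHom.mk' (mulPow p s) (mulPow_add s)

theorem mulPowHom_injective (s : ℕ) : Function.Injective (mulPowHom p s) :=
  (injective_iff_map_eq_zero _).2 fun _ => mulPow_eq_zero s

theorem map_mulPowHom_mul {a b c : ℕ} (s : ℕ) (g : ZMod (p ^ (s + 2)) →+* ZMod p)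
    (M : Matrix (Fin a) (Fin b) (ZMod (p ^ (s + 2)))) (E : Matrix (Fin b) (Fin c) (ZMod p)) :
    (M.map g * E).map (mulPowHom p s) = M * E.map (mulPowHom p s) := by
  ext i j
  simp only [map_apply, mul_apply, map_sum]
  exact Finset.sum_congr rfl fun l _ => mulPow_mul s g _ _

theorem mul_map_mulPowHom {a b c : ℕ} (s : ℕ) (g : ZMod (p ^ (s + 2)) →+* ZMod p)
    (E : Matrix (Fin a) (Fin b) (ZMod p)) (M : Matrix (Fin b) (Fin c) (ZMod (p ^ (s + 2)))) :
    (E * M.map g).map (mulPowHom p s) = E.map (mulPowHom p s) * M := by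
  ext i j
  simp only [map_apply, mul_apply, map_sum]
  refine Finset.sum_congr rfl fun l _ => ?_
  rw [mul_comm, mul_comm (mulPowHom p s _)]
  exact mulPow_mul s g _ _

/-- Linear maps into the field with `p ^ (n - m)` elements, and `m` independent elements of it. -/
theorem exists_galoisField_embedding {m n : ℕ} (hm : 1 ≤ m) (hn : 2 * m ≤ n)
    {A : Matrix (Fin m) (Fin n) (ZMod p)} {B : Matrix (Fin n) (Fin m) (ZMod p)} (hAB : A * B = 1) :
    ∃ (θ : Fin m → GaloisField p (n - m)) (φ : (Fin n → ZMod p) →ₗ[ZMod p] GaloisField p (n - m)),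
      LinearIndependent (ZMod p) θ ∧
        ∀ w ∈ LinearMap.ker B.vecMulLinear, φ w = 0 → w = 0 := by
  have hL : Module.finrank (ZMod p) (GaloisField p (n - m)) = n - m :=
    GaloisField.finrank p (by omega)
  have hsurj : Function.Surjective B.vecMulLinear := fun x =>
    ⟨x ᵥ* A, by simp [Matrix.vecMul_vecMul, hAB]⟩
  have hrank := LinearMap.finrank_range_add_finrank_ker B.vecMulLinear
  rw [LinearMap.range_eq_top.2 hsurj, finrank_top] at hrank
  simp only [Module.finrank_fintype_fun_eq_card, Fintype.card_fin] at hrank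
  have : FiniteDimensional (ZMod p) (GaloisField p (n - m)) :=
    Module.finite_of_finrank_pos (by omega)
  -- `B` acts onto an `m`-dimensional space, so its kernel has dimension `n - m`, the degree of the
  -- field.
  let e : LinearMap.ker B.vecMulLinear ≃ₗ[ZMod p] GaloisField p (n - m) :=
    LinearEquiv.ofFinrankEq _ _ (by omega)
  obtain ⟨φ, hφ⟩ := LinearMap.exists_extend e.toLinearMap
  let b := Module.finBasisOfFinrankEq (ZMod p) (GaloisField p (n - m)) hL
  -- Here `2 * m ≤ n` makes room for `m` independent elements.
  have hmn : m ≤ n - m := by omega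
  refine ⟨fun i => b (Fin.castLE hmn i), φ,
    b.linearIndependent.comp _ (Fin.castLE_injective hmn), fun w hw h => ?_⟩
  have h1 : e ⟨w, hw⟩ = 0 := by
    rw [← h]
    exact (LinearMap.congr_fun hφ ⟨w, hw⟩).symm
  exact congrArg Subtype.val (e.map_eq_zero_iff.1 h1)

/-- Pairwise close subspaces over `ℤ/pˢ⁺²` with the same reduction modulo `pˢ⁺¹`. -/
theorem card_le_of_baseChange_eq {k n s : ℕ} (hn : 2 * (k + 1) ≤ n)
    (f : ZMod (p ^ (s + 2)) →+* ZMod (p ^ (s + 1)))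
    (g : ZMod (p ^ (s + 2)) →+* ZMod p)
    (C : Finset (Submodule (ZMod (p ^ (s + 2))) (Fin n → ZMod (p ^ (s + 2)))))
    (hC : ∀ X ∈ C, IsSubspace (k + 1) X) (hclose : ∀ X ∈ C, ∀ Y ∈ C, X ≠ Y → Close k X Y)
    (X₀ : Submodule (ZMod (p ^ (s + 1))) (Fin n → ZMod (p ^ (s + 1))))
    (hred : ∀ X ∈ C, baseChange f X = X₀) : C.card ≤ p ^ (n - (k + 1)) := by
  rcases C.eq_empty_or_nonempty with rfl | ⟨Y₀, hY₀⟩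
  · simp
  obtain ⟨A₀, ⟨B, hB⟩, hA₀⟩ := hC Y₀ hY₀
  have hnorm : ∀ X : C, ∃ (A : Matrix (Fin (k + 1)) (Fin n) (ZMod (p ^ (s + 2))))
      (E : Matrix (Fin (k + 1)) (Fin n) (ZMod p)), A * B = 1 ∧
      Submodule.span _ (Set.range A.row) = X.1 ∧ A - A₀ = E.map (mulPowHom p s) := by
    intro X
    obtain ⟨A, h1, h2, h3⟩ := (hC X.1 X.2).exists_normalized_basis f hB
      ((hred X.1 X.2).trans (by rw [hA₀, hred Y₀ hY₀]))
    have h4 : ∀ i j, ∃ x, mulPow p s x = A i j - A₀ i j := fun i j =>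
      exists_mulPow_eq s f (by
        rw [map_sub, sub_eq_zero]; exact congrFun (congrFun h3 i) j)
    choose E hE using h4
    exact ⟨A, E, h1, h2, by ext i j; exact (hE i j).symm⟩
  choose A E hAB hspan hE using hnorm
  have hgB : A₀.map g * B.map g = 1 := by
    rw [← Matrix.map_mul, hB, Matrix.map_one g (map_zero g) (map_one g)]
  obtain ⟨θ, φ, hθ, hφ⟩ := exists_galoisField_embedding (by omega) hn hgB
  -- The target has `p^(n-(k+1))` elements, so injectivity is the whole bound.
  have hinj : Function.Injective fun X : C => ∑ i, θ i * φ (E X i) := by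
    intro X Y hXY
    by_contra hne
    obtain ⟨U, hU, hmem⟩ := hclose X X.2 Y Y.2 fun h => hne (Subtype.ext h)
    obtain ⟨T, hT⟩ := (forall_row_mem_span_iff U (A X)).1 fun i => by
      rw [hspan]; exact (hmem i).1
    obtain ⟨T', hT'⟩ := (forall_row_mem_span_iff U (A Y)).1 fun i => by
      rw [hspan]; exact (hmem i).2
    -- The bases share the right inverse `B`, so a common vector has the same coordinates in both.
    have hTT : T = T' := by
      have h1 := congrArg (· * B) (hT.symm.trans hT')
      simpa only [Matrix.mul_assoc, hAB, Matrix.mul_one] using h1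
    subst hTT
    have hTu : IsUnimodular T := by rw [hT] at hU; exact hU.of_mul
    have hdiff : A X - A Y = (E X - E Y).map (mulPowHom p s) := by
      rw [Matrix.map_sub _ (map_sub _), ← hE, ← hE, sub_sub_sub_cancel_right]
    have h0 : T.map g * (E X - E Y) = 0 := by
      apply Matrix.map_injective (mulPowHom_injective s)
      beta_reduce
      rw [map_mulPowHom_mul, ← hdiff, Matrix.mul_sub, ← hT, ← hT', sub_self,
        Matrix.map_zero _ (map_zero _)]
    have hK : ∀ i, (E X - E Y) i ∈ LinearMap.ker (B.map g).vecMulLinear := by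
      intro i
      have h1 : (E X - E Y) * B.map g = 0 := by
        apply Matrix.map_injective (mulPowHom_injective s)
        beta_reduce
        rw [mul_map_mulPowHom, ← hdiff, Matrix.sub_mul, hAB, hAB, sub_self,
          Matrix.map_zero _ (map_zero _)]
      exact congrFun h1 i
    have hsum : ∑ i, θ i * φ ((E X - E Y) i) = 0 := by
      have h1 : ∀ i, (E X - E Y) i = E X i - E Y i := fun _ => rfl
      simp only [h1, map_sub, mul_sub, Finset.sum_sub_distrib]
      exact sub_eq_zero.2 hXY
    have hEE := eq_zero_of_sum_mul_eq_zero hθ hφ (hTu.map g) h0 hK hsum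
    rw [hEE, Matrix.map_zero _ (map_zero _), sub_eq_zero] at hdiff
    exact hne (Subtype.ext (by rw [← hspan X, ← hspan Y, hdiff]))
  have : Finite (GaloisField p (n - (k + 1))) :=
    Nat.finite_of_card_ne_zero (by
      rw [GaloisField.card p _ (by omega)]; exact (pow_pos hp.out.pos _).ne')
  have h1 := Nat.card_le_card_of_injective _ hinj
  rwa [GaloisField.card p _ (by omega), Nat.card_eq_fintype_card, Fintype.card_coe] at h1

/-- Each extra power of `p` costs a factor `p^(n-(k+1))`; at modulus `p` itself `g` is bijective and
fibres are single points. -/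
theorem card_le_of_reduction_eq {k n : ℕ} (hn : 2 * (k + 1) ≤ n) (s : ℕ)
    (g : ZMod (p ^ (s + 1)) →+* ZMod p)
    (C : Finset (Submodule (ZMod (p ^ (s + 1))) (Fin n → ZMod (p ^ (s + 1)))))
    (hC : ∀ X ∈ C, IsSubspace (k + 1) X) (hclose : ∀ X ∈ C, ∀ Y ∈ C, X ≠ Y → Close k X Y)
    (X₀ : Submodule (ZMod p) (Fin n → ZMod p))
    (hred : ∀ X ∈ C, baseChange g X = X₀) : C.card ≤ p ^ (s * (n - (k + 1))) := by
  classical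
  induction s with
  | zero =>
    have hg : Function.Injective g :=
      ((Fintype.bijective_iff_surjective_and_card g).2
        ⟨ZMod.ringHom_surjective g, by simp [ZMod.card]⟩).1
    rw [zero_mul, pow_zero, Finset.card_le_one]
    intro X hX Y hY
    obtain ⟨A, ⟨B, hB⟩, rfl⟩ := hC X hX
    obtain ⟨A', -, rfl, h⟩ := (hC Y hY).exists_normalized_basis g hB
      ((hred Y hY).trans (hred _ hX).symm)
    rw [Matrix.map_injective hg h]
  | succ s ih =>
    let f : ZMod (p ^ (s + 2)) →+* ZMod (p ^ (s + 1)) :=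
      ZMod.castHom (pow_dvd_pow p (Nat.le_succ _)) _
    let g' : ZMod (p ^ (s + 1)) →+* ZMod p := ZMod.castHom (dvd_pow_self p s.succ_ne_zero) _
    have hgg : g'.comp f = g := Subsingleton.elim _ _
    have h1 : (C.image (baseChange f)).card ≤ p ^ (s * (n - (k + 1))) := by
      apply ih g'
      · simp only [Finset.mem_image]
        rintro _ ⟨X, hX, rfl⟩
        exact (hC X hX).baseChange f
      · simp only [Finset.mem_image]
        rintro _ ⟨X, hX, rfl⟩ _ ⟨Y, hY, rfl⟩ hne
        exact (hclose X hX Y hY fun h => hne (by rw [h])).baseChange f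
      · simp only [Finset.mem_image]
        rintro _ ⟨X, hX, rfl⟩
        rw [(hC X hX).baseChange_baseChange, hgg, hred X hX]
    calc C.card ≤ p ^ (n - (k + 1)) * (C.image (baseChange f)).card := by
          refine Finset.card_le_mul_card_image C _ fun Y _ => ?_
          refine card_le_of_baseChange_eq hn f g _
            (fun X hX => hC X (Finset.mem_filter.1 hX).1)
            (fun X hX Y hY => hclose X (Finset.mem_filter.1 hX).1 Y (Finset.mem_filter.1 hY).1) Y
            fun X hX => (Finset.mem_filter.1 hX).2
      _ ≤ p ^ (n - (k + 1)) * p ^ (s * (n - (k + 1))) := Nat.mul_le_mul_left _ h1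
      _ = p ^ ((s + 1) * (n - (k + 1))) := by ring

end Fibre

open Module

/-! ### Cliques of subspaces over a field -/

section Field

variable {F V : Type*} [Field F] [AddCommGroup V] [Module F V] [FiniteDimensional F V] {k n : ℕ}

theorem isUnimodular_of_linearIndependent {A : Matrix (Fin k) (Fin n) F}
    (hA : LinearIndependent F A.row) : IsUnimodular A := by
  obtain ⟨g, hg⟩ := LinearMap.exists_leftInverse_of_injective A.vecMulLinear
    (LinearMap.ker_eq_bot.2 (Matrix.vecMul_injective_iff.2 hA))
  refine ⟨(LinearMap.toMatrix' g)ᵀ, ?_⟩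
  apply Matrix.ext_of_single_vecMul
  intro i
  rw [← Matrix.vecMul_vecMul, Matrix.vecMul_transpose, LinearMap.toMatrix'_mulVec,
    Matrix.vecMul_one]
  exact LinearMap.congr_fun hg _

theorem isSubspace_iff_finrank {X : Submodule F (Fin n → F)} :
    IsSubspace k X ↔ finrank F X = k := by
  constructor
  · rintro ⟨A, hA, rfl⟩
    simpa using finrank_span_eq_card hA.linearIndependent
  · intro h
    let b := Module.finBasisOfFinrankEq F X h
    refine ⟨Matrix.of fun i => (b i : Fin n → F), isUnimodular_of_linearIndependent ?_, ?_⟩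
    · exact b.linearIndependent.map' X.subtype X.ker_subtype
    · have h1 := congrArg (Submodule.map X.subtype) b.span_eq
      rwa [Submodule.map_span, ← Set.range_comp, Submodule.map_top, Submodule.range_subtype] at h1

theorem Close.le_finrank {X Y : Submodule F (Fin n → F)} (h : Close k X Y) :
    k ≤ finrank F (X ⊓ Y : Submodule F (Fin n → F)) := by
  obtain ⟨U, hU, hmem⟩ := h
  have h1 : finrank F (Submodule.span F (Set.range U.row)) = k := by
    simpa using finrank_span_eq_card hU.linearIndependent
  rw [← h1]
  apply Submodule.finrank_mono
  rw [Submodule.span_le]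
  rintro _ ⟨i, rfl⟩
  exact hmem i

theorem finrank_inf_eq {X Y : Submodule F V} (hX : finrank F X = k + 1) (hY : finrank F Y = k + 1)
    (hne : X ≠ Y) (h : k ≤ finrank F (X ⊓ Y : Submodule F V)) :
    finrank F (X ⊓ Y : Submodule F V) = k := by
  by_contra h1
  have h2 : finrank F (X ⊓ Y : Submodule F V) ≤ k + 1 := hX ▸ Submodule.finrank_mono inf_le_left
  have h3 : X ⊓ Y = X := Submodule.eq_of_le_of_finrank_le inf_le_left (by omega)
  have h4 : X ⊓ Y = Y := Submodule.eq_of_le_of_finrank_le inf_le_right (by omega)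
  exact hne (h3.symm.trans h4)

/-- Pairwise adjacent subspaces have a common hyperplane, or are hyperplanes of a common space. -/
theorem exists_forall_le_or_exists_forall_ge {C : Set (Submodule F V)} (hnt : C.Nontrivial)
    (hC : ∀ X ∈ C, finrank F X = k + 1)
    (hadj : ∀ X ∈ C, ∀ Y ∈ C, X ≠ Y → k ≤ finrank F (X ⊓ Y : Submodule F V)) :
    (∃ P : Submodule F V, finrank F P = k ∧ ∀ X ∈ C, P ≤ X) ∨
      ∃ Q : Submodule F V, finrank F Q = k + 2 ∧ ∀ X ∈ C, X ≤ Q := by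
  obtain ⟨X, hX, Y, hY, hXY⟩ := hnt
  have hP := finrank_inf_eq (hC X hX) (hC Y hY) hXY (hadj X hX Y hY hXY)
  have hQ := Submodule.finrank_sup_add_finrank_inf_eq X Y
  rw [hP, hC X hX, hC Y hY] at hQ
  -- Such a `Z` meets `X` and `Y` in two different hyperplanes of `Z`, which together span it.
  have key : ∀ Z ∈ C, ¬ X ⊓ Y ≤ Z → Z ≤ X ⊔ Y := by
    intro Z hZ hPZ
    have hZX : Z ≠ X := fun h => hPZ (h ▸ inf_le_left)
    have hZY : Z ≠ Y := fun h => hPZ (h ▸ inf_le_right)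
    have h1 := finrank_inf_eq (hC Z hZ) (hC X hX) hZX (hadj Z hZ X hX hZX)
    have h2 := finrank_inf_eq (hC Z hZ) (hC Y hY) hZY (hadj Z hZ Y hY hZY)
    have h3 : ¬ Z ⊓ Y ≤ Z ⊓ X := fun h => hPZ <| by
      have h4 : Z ⊓ Y = X ⊓ Y := Submodule.eq_of_le_of_finrank_le
        (le_inf (h.trans inf_le_right) inf_le_right) (by omega)
      exact h4 ▸ inf_le_left
    have h5 : Z ⊓ X < (Z ⊓ X) ⊔ (Z ⊓ Y) :=
      lt_of_le_of_ne le_sup_left fun h => h3 (h ▸ le_sup_right)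
    have h6 := Submodule.finrank_lt_finrank_of_lt h5
    have h7 : (Z ⊓ X) ⊔ (Z ⊓ Y) = Z := Submodule.eq_of_le_of_finrank_le
      (sup_le inf_le_left inf_le_left) (by rw [hC Z hZ]; omega)
    rw [← h7]
    exact sup_le_sup inf_le_right inf_le_right
  by_contra! hcon
  obtain ⟨Z₁, hZ₁, hPZ₁⟩ := hcon.1 (X ⊓ Y) hP
  obtain ⟨Z₂, hZ₂, hQZ₂⟩ := hcon.2 (X ⊔ Y) (by omega)
  have hZ₁Q := key Z₁ hZ₁ hPZ₁
  have hPZ₂ : X ⊓ Y ≤ Z₂ := by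
    by_contra h
    exact hQZ₂ (key Z₂ hZ₂ h)
  have hne : Z₁ ≠ Z₂ := fun h => hPZ₁ (h ▸ hPZ₂)
  have h1 := finrank_inf_eq (hC _ hZ₁) (hC _ hZ₂) hne (hadj _ hZ₁ _ hZ₂ hne)
  have h2 : Z₂ ⊓ (X ⊔ Y) < Z₂ :=
    lt_of_le_of_ne inf_le_left fun h => hQZ₂ (inf_eq_left.1 h)
  have h3 := Submodule.finrank_lt_finrank_of_lt h2
  rw [hC _ hZ₂] at h3
  -- `Z₁` lies in `X ⊔ Y`, so `Z₁ ⊓ Z₂` lies in `Z₂ ⊓ (X ⊔ Y) = X ⊓ Y`; equal dimensions then put `X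
  -- ⊓ Y` inside `Z₁`, a contradiction.
  have h4 : X ⊓ Y = Z₂ ⊓ (X ⊔ Y) := Submodule.eq_of_le_of_finrank_le
    (le_inf hPZ₂ (inf_le_left.trans le_sup_left)) (by omega)
  have h5 : Z₁ ⊓ Z₂ = X ⊓ Y := Submodule.eq_of_le_of_finrank_le
    (h4 ▸ le_inf inf_le_right (inf_le_left.trans hZ₁Q)) (by omega)
  exact hPZ₁ (h5 ▸ inf_le_left)

end Field

/-! ### Sizes of stars and tops over `ZMod p` -/

section Counting

variable {p : ℕ} [hp : Fact p.Prime] {V : Type*} [AddCommGroup V] [Module (ZMod p) V]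
  [FiniteDimensional (ZMod p) V] {k d : ℕ}

/-- The number of `(k + 1)`-dimensional subspaces containing a `k`-dimensional one, in dimension
`k + d`. -/
theorem card_le_of_forall_le {P : Submodule (ZMod p) V} (hP : finrank (ZMod p) P = k)
    (hV : finrank (ZMod p) V = k + d) (C : Finset (Submodule (ZMod p) V))
    (hC : ∀ X ∈ C, finrank (ZMod p) X = k + 1) (hPC : ∀ X ∈ C, P ≤ X) :
    C.card ≤ ∑ i ∈ Finset.range d, p ^ i := by
  classical
  have : Finite V := Module.finite_of_finite (ZMod p)
  have hcard : ∀ X : Submodule (ZMod p) V, (X : Set V).ncard = p ^ finrank (ZMod p) X := by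
    intro X
    have h := Module.natCard_eq_pow_finrank (K := ZMod p) (V := X)
    rwa [Nat.card_zmod] at h
  have hcardV : Nat.card V = p ^ finrank (ZMod p) V := by
    have h := Module.natCard_eq_pow_finrank (K := ZMod p) (V := V)
    rwa [Nat.card_zmod] at h
  have hdiff : ∀ X ∈ C, ((X : Set V) \ P).ncard = p ^ k * (p - 1) := by
    intro X hX
    rw [Set.ncard_sdiff (hPC X hX), hcard, hcard, hC X hX, hP, pow_succ, Nat.mul_sub, mul_one]
  -- Distinct `X` meet exactly in `P`, so the sets `X \ P` are disjoint in the complement of `P`.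
  let f : (Σ X : C, ((X.1 : Set V) \ P : Set V)) → ((P : Set V)ᶜ : Set V) :=
    fun x => ⟨x.2.1, x.2.2.2⟩
  have hf : Function.Injective f := by
    rintro ⟨X, v, hv⟩ ⟨Y, w, hw⟩ h
    obtain rfl : v = w := congrArg Subtype.val h
    suffices hXY : X = Y by subst hXY; rfl
    by_contra hne
    have hne' : X.1 ≠ Y.1 := fun h => hne (Subtype.ext h)
    have h1 := finrank_inf_eq (hC _ X.2) (hC _ Y.2) hne'
      (hP ▸ Submodule.finrank_mono (le_inf (hPC _ X.2) (hPC _ Y.2)))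
    have h2 : P = X.1 ⊓ Y.1 := Submodule.eq_of_le_of_finrank_le
      (le_inf (hPC _ X.2) (hPC _ Y.2)) (by omega)
    exact hv.2 (h2 ▸ ⟨hv.1, hw.1⟩)
  have hle := Nat.card_le_card_of_injective f hf
  rw [Nat.card_sigma, Finset.sum_congr rfl fun X _ => (Nat.card_coe_set_eq _).trans
    (hdiff X.1 X.2), Finset.sum_const, Finset.card_univ, Fintype.card_coe, smul_eq_mul,
    Nat.card_coe_set_eq, Set.ncard_compl, hcardV, hcard, hP, hV] at hle
  have hgeom := Nat.geomSum_eq hp.out.two_le d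
  have h1 : p ^ k * (C.card * (p - 1)) ≤ p ^ k * (p ^ d - 1) := by
    rw [Nat.mul_sub (p ^ k), mul_one, ← pow_add]
    calc _ = C.card * (p ^ k * (p - 1)) := by ring
      _ ≤ _ := hle
  rw [hgeom, Nat.le_div_iff_mul_le (Nat.sub_pos_of_lt hp.out.one_lt)]
  exact Nat.le_of_mul_le_mul_left h1 (pow_pos hp.out.pos _)

/-- The number of hyperplanes of a space of dimension `d`. -/
theorem card_le_of_forall_ge {Q : Submodule (ZMod p) V} (hQ : finrank (ZMod p) Q = k + 1)
    (C : Finset (Submodule (ZMod p) V))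
    (hC : ∀ X ∈ C, finrank (ZMod p) X = k) (hQC : ∀ X ∈ C, X ≤ Q) :
    C.card ≤ ∑ i ∈ Finset.range (k + 1), p ^ i := by
  classical
  have hQ' := Subspace.finrank_add_finrank_dualAnnihilator_eq Q
  rw [← Finset.card_image_of_injective C fun X Y h => Subspace.dualAnnihilator_inj.1 h]
  -- Annihilators turn hyperplanes of `Q` into spaces one dimension above the annihilator of `Q`.
  refine card_le_of_forall_le (P := Q.dualAnnihilator) rfl ?_ _ ?_ ?_
  · rw [Subspace.dual_finrank_eq]; omega
  · simp only [Finset.mem_image]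
    rintro _ ⟨X, hX, rfl⟩
    have h := Subspace.finrank_add_finrank_dualAnnihilator_eq X
    rw [hC X hX] at h
    omega
  · simp only [Finset.mem_image]
    rintro _ ⟨X, hX, rfl⟩
    exact Submodule.dualAnnihilator_anti (hQC X hX)

end Counting

/-! ### An explicit star -/

section Star

variable {R : Type*} [CommRing R] {k N : ℕ}

/-- The rows `e₁, …, eₖ` of length `k + N`. -/
def coordRows (R : Type*) [CommRing R] (k N : ℕ) : Matrix (Fin k) (Fin (k + N)) R :=
  Matrix.of fun i => Pi.single (Fin.castAdd N i) 1

/-- The rows `e₁, …, eₖ` of length `k + N`, followed by the row `(0, v)`. -/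
def starMatrix (k : ℕ) (v : Fin N → R) : Matrix (Fin (k + 1)) (Fin (k + N)) R :=
  Matrix.of (Fin.snoc (α := fun _ => Fin (k + N) → R) (coordRows R k N) (Fin.append 0 v))

theorem starMatrix_castSucc (v : Fin N → R) (i : Fin k) :
    starMatrix k v i.castSucc = Pi.single (Fin.castAdd N i) 1 :=
  Fin.snoc_castSucc (α := fun _ => Fin (k + N) → R) _ _ i

theorem starMatrix_last (v : Fin N → R) :
    starMatrix k v (Fin.last k) = Fin.append 0 v :=
  Fin.snoc_last (α := fun _ => Fin (k + N) → R) _ _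

theorem isUnimodular_coordRows : IsUnimodular (coordRows R k N) := by
  refine ⟨(coordRows R k N)ᵀ, ?_⟩
  ext i j
  simp [coordRows, mul_apply, Pi.single_apply, one_apply, eq_comm]

theorem isUnimodular_starMatrix {v : Fin N → R} {j : Fin N} (hj : IsUnit (v j)) :
    IsUnimodular (starMatrix k v) := by
  obtain ⟨u, hu⟩ := hj
  -- The vector `u⁻¹ eⱼ` pairs with `v` to `1`.
  refine ⟨(starMatrix k (Pi.single j (↑u⁻¹ : R)))ᵀ, ?_⟩
  ext a b
  rw [mul_apply']
  change starMatrix k v a ⬝ᵥ starMatrix k _ b = _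
  induction a using Fin.lastCases with
  | last =>
    induction b using Fin.lastCases with
    | last => simp [starMatrix_last, dotProduct, Fin.sum_univ_add, ← hu, Pi.single_apply]
    | cast b =>
      simp [starMatrix_last, starMatrix_castSucc, one_apply, (Fin.castSucc_lt_last b).ne']
  | cast a =>
    induction b using Fin.lastCases with
    | last => simp [starMatrix_last, starMatrix_castSucc, one_apply, (Fin.castSucc_lt_last a).ne]
    | cast b => simp [starMatrix_castSucc, one_apply, Pi.single_apply, eq_comm]

theorem coordRows_mem (v : Fin N → R) (i : Fin k) :
    (coordRows R k N).row i ∈ Submodule.span R (Set.range (starMatrix k v).row) := by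
  refine Submodule.subset_span ⟨i.castSucc, ?_⟩
  exact starMatrix_castSucc v i

/-- Only the last row is nonzero in the last `N` coordinates; `c` is its coefficient. -/
theorem exists_eq_smul_of_span_eq {v w : Fin N → R}
    (h : Submodule.span R (Set.range (starMatrix k w).row) =
      Submodule.span R (Set.range (starMatrix k v).row)) : ∃ c : R, w = c • v := by
  have h1 : (starMatrix k w).row (Fin.last k) ∈
      Submodule.span R (Set.range (starMatrix k v).row) := h ▸ Submodule.subset_span ⟨_, rfl⟩
  obtain ⟨c, hc⟩ := (mem_span_row_iff _ _).1 h1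
  refine ⟨c (Fin.last k), funext fun j => ?_⟩
  have h2 := congrFun hc (Fin.natAdd k j)
  simp only [vecMul, dotProduct, Fin.sum_univ_castSucc, starMatrix_castSucc, starMatrix_last,
    row] at h2
  simpa [Pi.single_apply, Fin.ext_iff, Nat.ne_of_gt (Nat.lt_add_right _ (Fin.is_lt _)),
    Nat.ne_of_lt (Nat.lt_add_right _ (Fin.is_lt _))] using h2.symm

end Star

/-! ### The star attains the bound -/

section LowerBound

variable {p : ℕ} [hp : Fact p.Prime]

theorem card_units_zmod_primePow (s : ℕ) :
    Nat.card (ZMod (p ^ (s + 1)))ˣ = p ^ s * (p - 1) := by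
  rw [Nat.card_eq_fintype_card, ZMod.card_units_eq_totient,
    Nat.totient_prime_pow_succ hp.out]

theorem card_nonunits_zmod_primePow (s : ℕ) :
    Nat.card {x : ZMod (p ^ (s + 1)) // ¬ IsUnit x} = p ^ s := by
  classical
  have h1 : Nat.card {x : ZMod (p ^ (s + 1)) // IsUnit x} = p ^ s * (p - 1) := by
    rw [← card_units_zmod_primePow]
    exact (Nat.card_congr (Equiv.ofBijective
      (fun u : (ZMod (p ^ (s + 1)))ˣ => (⟨u, u.isUnit⟩ : {x : ZMod (p ^ (s + 1)) // IsUnit x}))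
      ⟨fun u v h => Units.ext (congrArg Subtype.val h),
        fun ⟨_, u, hu⟩ => ⟨u, Subtype.ext hu⟩⟩)).symm
  rw [Nat.card_eq_fintype_card] at h1 ⊢
  rw [Fintype.card_subtype_compl, h1, ZMod.card, Nat.mul_sub, mul_one, pow_succ]
  exact Nat.sub_sub_self (Nat.le_mul_of_pos_right _ hp.out.pos)

/-- A star is a clique with at least `p ^ (s * d) * (1 + p + ⋯ + p ^ d)` elements. -/
theorem exists_isClique_le_card (s k d : ℕ) :
    ∃ M : Finset (Vertex (ZMod (p ^ (s + 1))) (k + (d + 1)) (k + 1)),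
      (graph (ZMod (p ^ (s + 1))) (k + (d + 1)) (k + 1)).IsClique M ∧
        p ^ (s * d) * ∑ i ∈ Finset.range (d + 1), p ^ i ≤ M.card := by
  classical
  let R : Type := ZMod (p ^ (s + 1))
  let U : Type := {v : Fin (d + 1) → R // ¬ ∀ j, ¬ IsUnit (v j)}
  have hU : ∀ v : U, IsUnimodular (starMatrix k v.1) := fun v => by
    obtain ⟨j, hj⟩ := not_forall.1 v.2
    exact isUnimodular_starMatrix (not_not.1 hj)
  let f : U → Vertex R (k + (d + 1)) (k + 1) := fun v => ⟨_, _, hU v, rfl⟩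
  refine ⟨Finset.univ.image f, ?_, ?_⟩
  · rw [Finset.coe_image]
    rintro _ ⟨v, -, rfl⟩ _ ⟨w, -, rfl⟩ hne
    exact (graph_adj_iff _ _).2 ⟨hne, _, isUnimodular_coordRows,
      fun i => ⟨coordRows_mem _ i, coordRows_mem _ i⟩⟩
  -- Vectors with the same subspace differ by a scalar, a unit because some coordinate is one; so
  -- each fibre has at most as many elements as there are units.
  · have hfib : Fintype.card U ≤ p ^ s * (p - 1) * (Finset.univ.image f).card := by
      refine Finset.card_le_mul_card_image Finset.univ _ fun Y hY => ?_
      obtain ⟨v, -, rfl⟩ := Finset.mem_image.1 hY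
      rw [← card_units_zmod_primePow, Nat.card_eq_fintype_card, ← Finset.card_univ,
        ← Finset.card_map ⟨Subtype.val, Subtype.val_injective⟩]
      refine (Finset.card_le_card (t := Finset.univ.image fun c : Rˣ => (c : R) • v.1) ?_).trans
        Finset.card_image_le
      intro x hx
      obtain ⟨w, hw, rfl⟩ := Finset.mem_map.1 hx
      have hfw : f w = f v := (Finset.mem_filter.1 hw).2
      obtain ⟨c, hc⟩ := exists_eq_smul_of_span_eq (congrArg Subtype.val hfw)
      obtain ⟨j, hj⟩ := not_forall.1 w.2
      rw [not_not, hc] at hj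
      obtain ⟨u, hu⟩ : IsUnit c := isUnit_of_mul_isUnit_left hj
      exact Finset.mem_image.2 ⟨u, Finset.mem_univ _, by rw [hu]; exact hc.symm⟩
    have hUcard : Fintype.card U = (p ^ (s + 1)) ^ (d + 1) - (p ^ s) ^ (d + 1) := by
      have h1 : Fintype.card {v : Fin (d + 1) → R // ∀ j, ¬ IsUnit (v j)} = (p ^ s) ^ (d + 1) := by
        rw [Fintype.card_congr (Equiv.subtypePiEquivPi (p := fun _ x => ¬ IsUnit x)),
          Fintype.card_pi, Finset.prod_const, ← Nat.card_eq_fintype_card,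
          card_nonunits_zmod_primePow, Finset.card_univ, Fintype.card_fin]
      rw [Fintype.card_subtype_compl, h1, Fintype.card_fun, ZMod.card, Fintype.card_fin]
    have hgeom := Nat.geomSum_eq hp.out.two_le (d + 1)
    have hg : (∑ i ∈ Finset.range (d + 1), p ^ i) * (p - 1) = p ^ (d + 1) - 1 := by
      rw [hgeom]
      exact Nat.div_mul_cancel (by simpa using Nat.sub_dvd_pow_sub_pow p 1 (d + 1))
    refine Nat.le_of_mul_le_mul_left ?_
      (Nat.mul_pos (pow_pos hp.out.pos s) (Nat.sub_pos_of_lt hp.out.one_lt))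
    refine le_trans (le_of_eq ?_) hfib
    calc p ^ s * (p - 1) * (p ^ (s * d) * ∑ i ∈ Finset.range (d + 1), p ^ i)
        = p ^ (s * (d + 1)) * ((∑ i ∈ Finset.range (d + 1), p ^ i) * (p - 1)) := by ring
      _ = _ := by
        rw [hg, hUcard, Nat.mul_sub, mul_one, ← pow_mul, ← pow_mul, ← pow_add]
        congr 2
        ring

end LowerBound

/-- The submodule underlying a vertex of the Grassmann graph. -/
def Vertex.toSubmodule {R : Type*} [CommRing R] {n m : ℕ} (X : Vertex R n m) :
    Submodule R (Fin n → R) :=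
  X.1

theorem Vertex.toSubmodule_injective {R : Type*} [CommRing R] {n m : ℕ} :
    Function.Injective (Vertex.toSubmodule (R := R) (n := n) (m := m)) :=
  Subtype.val_injective

/-! ### Extremal cliques and their reductions -/

section Clique

variable {p : ℕ} [hp : Fact p.Prime] {k d : ℕ}

/-- Cliques of the Grassmann graph over a prime field. -/
theorem card_le_and_isStar_or_isTop (hkd : k + 1 ≤ d)
    (C : Finset (Vertex (ZMod p) (k + (d + 1)) (k + 1)))
    (hC : ∀ X ∈ C, ∀ Y ∈ C, X ≠ Y → Close k X.1 Y.1) :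
    C.card ≤ ∑ i ∈ Finset.range (d + 1), p ^ i ∧
      (∑ i ∈ Finset.range (d + 1), p ^ i ≤ C.card →
        IsStar (C : Set (Vertex (ZMod p) (k + (d + 1)) (k + 1))) ∨
          (d = k + 1 ∧ IsTop (C : Set (Vertex (ZMod p) (k + (d + 1)) (k + 1))))) := by
  classical
  have := Fintype.ofFinite (Vertex (ZMod p) (k + (d + 1)) (k + 1))
  have hfin : ∀ X : Vertex (ZMod p) (k + (d + 1)) (k + 1),
      Module.finrank (ZMod p) X.1 = k + 1 := fun X => isSubspace_iff_finrank.1 X.2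
  have hmono : ∀ {a b : ℕ}, a < b → ∑ i ∈ Finset.range a, p ^ i < ∑ i ∈ Finset.range b, p ^ i :=
    fun {a b} hab => Finset.sum_lt_sum_of_subset (i := a)
      (Finset.range_subset_range.2 hab.le) (by simpa) (by simp) (pow_pos hp.out.pos _) (by simp)
  -- The star-or-top dichotomy needs two members; smaller cliques lie strictly below the bound.
  by_cases hnt : C.card ≤ 1
  · have h1 := hmono (show 1 < d + 1 by omega)
    simp only [Finset.sum_range_one, pow_zero] at h1
    exact ⟨by omega, fun h => absurd h (by omega)⟩
  obtain ⟨X, hX, Y, hY, hXY⟩ := Finset.one_lt_card.1 (not_le.1 hnt)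
  have hval : ∀ D : Finset (Vertex (ZMod p) (k + (d + 1)) (k + 1)),
      (D.image Vertex.toSubmodule).card = D.card := fun D =>
    Finset.card_image_of_injective D Vertex.toSubmodule_injective
  rcases exists_forall_le_or_exists_forall_ge (k := k)
      (C := (Subtype.val '' (C : Set (Vertex (ZMod p) (k + (d + 1)) (k + 1)))))
      ⟨X.1, ⟨X, hX, rfl⟩, Y.1, ⟨Y, hY, rfl⟩, fun h => hXY (Subtype.ext h)⟩
      (by rintro _ ⟨Z, -, rfl⟩; exact hfin Z)
      (by
        rintro _ ⟨Z, hZ, rfl⟩ _ ⟨W, hW, rfl⟩ hne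
        exact (hC Z hZ W hW fun h => hne (h ▸ rfl)).le_finrank) with
    ⟨P, hP, hPC⟩ | ⟨Q, hQ, hQC⟩
  · have hsub : C ⊆ Finset.univ.filter fun Z => P ≤ Z.1 := fun Z hZ =>
      Finset.mem_filter.2 ⟨Finset.mem_univ _, hPC _ ⟨Z, hZ, rfl⟩⟩
    have hcard : (Finset.univ.filter fun Z : Vertex (ZMod p) (k + (d + 1)) (k + 1) =>
        P ≤ Z.1).card ≤ ∑ i ∈ Finset.range (d + 1), p ^ i := by
      rw [← hval]
      refine card_le_of_forall_le hP (by simp) _ ?_ ?_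
      · simp only [Finset.mem_image]
        rintro _ ⟨Z, -, rfl⟩
        exact hfin Z
      · simp only [Finset.mem_image, Finset.mem_filter]
        rintro _ ⟨Z, hZ, rfl⟩
        exact hZ.2
    refine ⟨(Finset.card_le_card hsub).trans hcard, fun h => Or.inl ?_⟩
    refine ⟨k, P, rfl, isSubspace_iff_finrank.2 hP, ?_⟩
    rw [Finset.eq_of_subset_of_card_le hsub (hcard.trans h)]
    simp
  · have hsub : C ⊆ Finset.univ.filter fun Z => Z.1 ≤ Q := fun Z hZ =>
      Finset.mem_filter.2 ⟨Finset.mem_univ _, hQC _ ⟨Z, hZ, rfl⟩⟩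
    have hcard : (Finset.univ.filter fun Z : Vertex (ZMod p) (k + (d + 1)) (k + 1) =>
        Z.1 ≤ Q).card ≤ ∑ i ∈ Finset.range (k + 2), p ^ i := by
      rw [← hval]
      refine card_le_of_forall_ge hQ _ ?_ ?_
      · simp only [Finset.mem_image]
        rintro _ ⟨Z, -, rfl⟩
        exact hfin Z
      · simp only [Finset.mem_image, Finset.mem_filter]
        rintro _ ⟨Z, hZ, rfl⟩
        exact hZ.2
    have hle := (Finset.card_le_card hsub).trans hcard
    -- Tops are as large as stars when `d = k + 1` and strictly smaller otherwise.
    rcases hkd.eq_or_lt with rfl | hlt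
    · refine ⟨hle, fun h => Or.inr ⟨rfl, Q, isSubspace_iff_finrank.2 hQ, ?_⟩⟩
      rw [Finset.eq_of_subset_of_card_le hsub (hcard.trans h)]
      simp
    · have h1 := hmono (show k + 2 < d + 1 by omega)
      exact ⟨by omega, fun h => absurd h (by omega)⟩

/-- Cliques of the Grassmann graph over `ℤ/pᵗ⁺¹` and their reductions modulo `p`. -/
theorem card_le_and_reduction (t : ℕ) (hkd : k + 1 ≤ d)
    {M : Finset (Vertex (ZMod (p ^ (t + 1))) (k + (d + 1)) (k + 1))}
    (hM : (graph (ZMod (p ^ (t + 1))) (k + (d + 1)) (k + 1)).IsClique M) :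
    M.card ≤ p ^ (t * d) * ∑ i ∈ Finset.range (d + 1), p ^ i ∧
      (p ^ (t * d) * ∑ i ∈ Finset.range (d + 1), p ^ i ≤ M.card →
        IsStar (reduction p (t + 1) (k + (d + 1)) (k + 1) t.succ_ne_zero '' (M : Set _)) ∨
          (d = k + 1 ∧
            IsTop (reduction p (t + 1) (k + (d + 1)) (k + 1) t.succ_ne_zero '' (M : Set _)))) := by
  classical
  let r := reduction p (t + 1) (k + (d + 1)) (k + 1) t.succ_ne_zero
  have hclose : ∀ X ∈ M, ∀ Y ∈ M, X ≠ Y → Close k X.1 Y.1 := fun X hX Y hY hne =>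
    ((graph_adj_iff X Y).1 (hM hX hY hne)).2
  have hpos : 0 < p ^ (t * d) := pow_pos hp.out.pos _
  have hfib : M.card ≤ p ^ (t * d) * (M.image r).card := by
    refine Finset.card_le_mul_card_image M _ fun Y _ => ?_
    have h := card_le_of_reduction_eq (p := p) (k := k) (n := k + (d + 1)) (by omega) t
      (ZMod.castHom (dvd_pow_self p t.succ_ne_zero) (ZMod p))
      ((M.filter fun X => r X = Y).image Vertex.toSubmodule)
      (by
        simp only [Finset.mem_image]
        rintro _ ⟨X, -, rfl⟩
        exact X.2)
      (by
        simp only [Finset.mem_image, Finset.mem_filter]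
        rintro _ ⟨X, hX, rfl⟩ _ ⟨Z, hZ, rfl⟩ hne
        exact hclose X hX.1 Z hZ.1 fun h => hne (h ▸ rfl))
      Y.1
      (by
        simp only [Finset.mem_image, Finset.mem_filter]
        rintro _ ⟨X, hX, rfl⟩
        exact congrArg Subtype.val hX.2)
    rw [Finset.card_image_of_injective _ Vertex.toSubmodule_injective] at h
    rwa [show k + (d + 1) - (k + 1) = d by omega] at h
  obtain ⟨h1, h2⟩ := card_le_and_isStar_or_isTop hkd (M.image r) (by
    simp only [Finset.mem_image]
    rintro _ ⟨X, hX, rfl⟩ _ ⟨Y, hY, rfl⟩ hne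
    exact (hclose X hX Y hY fun h => hne (h ▸ rfl)).baseChange _)
  rw [Finset.coe_image] at h2
  -- If `M` reaches the bound, cancelling the fibre factor shows that its image is extremal.
  exact ⟨hfib.trans (Nat.mul_le_mul_left _ h1),
    fun h => h2 (Nat.le_of_mul_le_mul_left (h.trans hfib) hpos)⟩

theorem gaussBinom_one (d : ℕ) :
    gaussBinom p (d + 1) 1 = ((∑ i ∈ Finset.range (d + 1), p ^ i : ℕ) : ℚ) := by
  have h : (p : ℚ) ≠ 1 := by exact_mod_cast hp.out.one_lt.ne'
  push_cast
  rw [geom_sum_eq h]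
  simp [gaussBinom]

end Clique

end Grassmann

/-! ### The main theorem -/

theorem theorem4p4 (p s n m : ℕ) [Fact p.Prime] (hs : s ≠ 0) (hm : 1 ≤ m) (hn : 2 * m ≤ n) :
    ((Grassmann.graph (ZMod (p ^ s)) n m).cliqueNum : ℚ) =
        (p : ℚ) ^ ((s - 1) * (n - m)) * Grassmann.gaussBinom p (n - m + 1) 1 ∧
      ∀ M : Finset (Grassmann.Vertex (ZMod (p ^ s)) n m),
        (Grassmann.graph (ZMod (p ^ s)) n m).IsMaximumClique M →
          (2 * m < n →
            Grassmann.IsStar (Grassmann.reduction p s n m hs '' (M : Set _))) ∧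
          (n = 2 * m →
            Grassmann.IsStar (Grassmann.reduction p s n m hs '' (M : Set _)) ∨
              Grassmann.IsTop (Grassmann.reduction p s n m hs '' (M : Set _))) := by
  -- Put `s = t + 1`, `m = k + 1` and `d = n - m`; then `n = 2 * m` means `d = k + 1`.
  obtain ⟨t, rfl⟩ := Nat.exists_eq_succ_of_ne_zero hs
  obtain ⟨k, rfl⟩ := Nat.exists_eq_add_of_le' hm
  obtain ⟨d, rfl⟩ : ∃ d, n = k + (d + 1) := ⟨n - (k + 1), by omega⟩
  have hkd : k + 1 ≤ d := by omega
  obtain ⟨S, hS, hScard⟩ := Grassmann.exists_isClique_le_card (p := p) t k d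
  obtain ⟨T, hT⟩ :=
    (Grassmann.graph (ZMod (p ^ (t + 1))) (k + (d + 1)) (k + 1)).exists_isNClique_cliqueNum
  have hω : (Grassmann.graph (ZMod (p ^ (t + 1))) (k + (d + 1)) (k + 1)).cliqueNum =
      p ^ (t * d) * ∑ i ∈ Finset.range (d + 1), p ^ i := by
    refine le_antisymm ?_ (hScard.trans hS.card_le_cliqueNum)
    rw [← hT.card_eq]
    exact (Grassmann.card_le_and_reduction t hkd hT.isClique).1
  refine ⟨?_, fun M hM => ?_⟩
  · rw [Nat.succ_eq_add_one, hω, show k + (d + 1) - (k + 1) = d by omega,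
      Grassmann.gaussBinom_one]
    push_cast
    rfl
  · have h := (Grassmann.card_le_and_reduction t hkd hM.isClique).2
      (hScard.trans (hM.maximum S hS))
    refine ⟨fun hlt => ?_, fun _ => ?_⟩
    · exact h.resolve_right fun h1 => by omega
    · exact h.imp_right And.right
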